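/- Let $X$ and $Y$ be Banach spaces (real or complex), and let $T\colon D(T)\subset X\to Y$ be a closed linear operator: $D(T)$ is a linear subspace of $X$ and the graph $G(T)=\{(x,Tx):x\in D(T)\}$ is a closed subspace of $X\times Y$. Identify $X$ with the closed subspace $X\times\{0\}$ of $X\times Y$. Notation. A Banach space $E$ is regarded as a subspace of its second dual $E^{**}$, and $E^{co}:=E^{**}/E$. A bounded operator $S\colon E\to F$ between Banach spaces induces the operator $S^{co}\colon E^{co}\to F^{co}$, $S^{co}(x^{**}+E)=S^{**}x^{**}+F$, and $S$ is called tauberian if $S^{**}(E^{**}\setminus E)\subset F^{**}\setminus F$. For closed subspaces $M,N$ of a Banach space $Z$, let $J_M\colon M\to Z$ be the inclusion and $Q_N\colon Z\to Z/N$ the quotient map; $M^{co}\subset Z^{co}$ denotes the range of $(J_M)^{co}$, and the pair $(M,N)$ is called tauberian if the operator $Q_NJ_M\colon M\to Z/N$ is tauberian. Then the following assertions are equivalent: (i) the pair $(G(T),X)$ of closed subspaces of $X\times Y$ is tauberian; (ii) $G(T)^{co}\cap X^{co}=\{0\}$, where $G(T)^{co}$ and $X^{co}$ are the subspaces of $(X\times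 Y)^{co}$ associated with the closed subspaces $G(T)$ and $X=X\times\{0\}$ of $X\times Y$; (iii) for every bounded sequence $(x_n)$ in $D(T)$ (bounded in the norm of $X$) such that $(Tx_n)$ converges weakly to some $y\in Y$, there is a subsequence of $(x_n)$ that converges weakly in $X$ to some $x\in D(T)$ with $Tx=y$. -/

import Mathlib

set_option maxSynthPendingDepth 3

open Filter Topology

noncomputable section

namespace TauberianPair

section Operators

variable {𝕜 : Type*} [RCLike 𝕜]
variable {E F : Type*} [SeminormedAddCommGroup E] [NormedSpace 𝕜 E]
  [SeminormedAddCommGroup F] [NormedSpace 𝕜 F]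

/-- The conjugate operator `S* : F* → E*`, `S* f = f ∘ S`. -/
def conjugate (S : E →L[𝕜] F) : StrongDual 𝕜 F →L[𝕜] StrongDual 𝕜 E :=
  ContinuousLinearMap.precomp 𝕜 S

variable (𝕜 E) in
/-- The second dual `E**`. -/
abbrev Bidual : Type _ := StrongDual 𝕜 (StrongDual 𝕜 E)

/-- The second conjugate operator `S** : E** → F**`. -/
def secondConjugate (S : E →L[𝕜] F) : Bidual 𝕜 E →L[𝕜] Bidual 𝕜 F :=
  conjugate (conjugate S)

variable (𝕜 E) in
/-- The canonical copy of `E` inside its second dual `E**`. -/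
def canonicalCopy : Submodule 𝕜 (Bidual 𝕜 E) :=
  LinearMap.range (NormedSpace.inclusionInDoubleDual 𝕜 E).toLinearMap

/-- `S` is tauberian: `S**` maps `E** \ E` into `F** \ F`. -/
def IsTauberian (S : E →L[𝕜] F) : Prop :=
  Set.MapsTo (secondConjugate S)
    ((canonicalCopy 𝕜 E : Set (Bidual 𝕜 E))ᶜ) ((canonicalCopy 𝕜 F : Set (Bidual 𝕜 F))ᶜ)

variable (𝕜 E) in
/-- The residual space `E^co = E** / E`. -/
abbrev Residual : Type _ := Bidual 𝕜 E ⧸ canonicalCopy 𝕜 E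

/-- `S**` extends `S`, so it maps the copy of `E` into the copy of `F`. -/
theorem canonicalCopy_le_comap (S : E →L[𝕜] F) :
    canonicalCopy 𝕜 E ≤ (canonicalCopy 𝕜 F).comap (secondConjugate S).toLinearMap := by
  rintro _ ⟨x, rfl⟩
  exact ⟨S x, rfl⟩

/-- The residuum operator `S^co : E^co → F^co`, `S^co (x** + E) = S** x** + F`. -/
def residuum (S : E →L[𝕜] F) : Residual 𝕜 E →ₗ[𝕜] Residual 𝕜 F :=
  (canonicalCopy 𝕜 E).mapQ (canonicalCopy 𝕜 F) (secondConjugate S).toLinearMap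
    (canonicalCopy_le_comap S)

end Operators

section Pairs

variable {𝕜 : Type*} [RCLike 𝕜]
variable {Z : Type*} [NormedAddCommGroup Z] [NormedSpace 𝕜 Z]

/-- For a closed subspace `M` of `Z`, the subspace `M^co` of `Z^co`: the range of `(J_M)^co`,
where `J_M : M → Z` is the inclusion. -/
def co (M : ClosedSubmodule 𝕜 Z) : Submodule 𝕜 (Residual 𝕜 Z) :=
  LinearMap.range (residuum M.toSubmodule.subtypeL)

/-- The operator `Q_N J_M : M → Z / N` of a pair of closed subspaces of `Z`. -/
def pairOperator (M N : ClosedSubmodule 𝕜 Z) : M.toSubmodule →L[𝕜] (Z ⧸ N.toSubmodule) :=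
  N.toSubmodule.mkQL ∘L M.toSubmodule.subtypeL

/-- The pair `(M, N)` is tauberian when the operator `Q_N J_M` is tauberian. -/
def IsTauberianPair (M N : ClosedSubmodule 𝕜 Z) : Prop :=
  IsTauberian (pairOperator M N)

end Pairs

section ClosedOperators

variable {𝕜 : Type*} [RCLike 𝕜]
variable {X Y : Type*} [NormedAddCommGroup X] [NormedSpace 𝕜 X]
  [NormedAddCommGroup Y] [NormedSpace 𝕜 Y]

/-- The graph of a closed operator, as a closed subspace of `X × Y`. -/
def closedGraph (T : X →ₗ.[𝕜] Y) (hT : T.IsClosed) : ClosedSubmodule 𝕜 (X × Y) :=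
  ⟨T.graph, hT⟩

variable (𝕜 X Y) in
/-- The space `X`, identified with the closed subspace `X × {0}` of `X × Y`. -/
def firstFactor : ClosedSubmodule 𝕜 (X × Y) :=
  ⟨(⊤ : Submodule 𝕜 X).prod (⊥ : Submodule 𝕜 Y), by
    have h : IsClosed ((Set.univ : Set X) ×ˢ ({0} : Set Y)) := isClosed_univ.prod isClosed_singleton
    simpa using h⟩

end ClosedOperators

end TauberianPair

end

noncomputable section

namespace TauberianPair

/-! ### Weak compactness: Eberlein–Šmulian and Whitley sequences -/

section WeakSequences

variable {𝕜 : Type*} [RCLike 𝕜]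
variable {E : Type*} [NormedAddCommGroup E] [NormedSpace 𝕜 E]

/-! (i) ⇔ (ii) holds for any pair of closed subspaces. A functional `m` in `M**` is sent into `Z/N`
by `(Q_N J_M)**` exactly when `J_M** m` differs from some `z` in `Z` by an element of the kernel of
`Q_N**`. That kernel is the range of `J_N**`, and `J_M` is itself tauberian, so `(J_M)^co` is
injective.

(i) ⇔ (iii): since `(X × Y)/X` is `Y`, the pair operator is in essence `(x, Tx) ↦ Tx`. If it is
tauberian, every weak* cluster point of a bounded sequence with weakly convergent images lies in
`G(T)`, and `exists_subseq_weakly_tendsto` extracts a weakly convergent subsequence. Conversely, let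
`S** w = q` lie in the quotient. Helly's condition and Whitley's construction
(`exists_bounded_seq_of_secondConjugate_eq`) give a bounded sequence whose images tend to `q` in
norm and whose only possible weak subsequential limit is `w`; (iii) supplies such a limit, so `w`
lies in `G(T)`. -/

theorem eq_of_mapClusterPt_of_tendsto {α R : Type*} [TopologicalSpace R] [T2Space R] {l : Filter α}
    {u : α → R} {a b : R} (ha : MapClusterPt a l u) (hb : Tendsto u l (𝓝 b)) : a = b := by
  have : (𝓝 a ⊓ 𝓝 b).NeBot := NeBot.mono ha (inf_le_inf_left _ hb)
  exact eq_of_nhds_neBot this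

/-- Hahn–Banach in the quotient: closedness of `p` makes the class of `a` have nonzero norm. -/
theorem exists_dual_eq_zero_of_notMem {p : Submodule 𝕜 E} (hp : IsClosed (p : Set E)) {a : E}
    (ha : a ∉ p) : ∃ f : StrongDual 𝕜 E, (∀ x ∈ p, f x = 0) ∧ f a ≠ 0 := by
  have hne : ‖p.mkQL a‖ ≠ 0 := fun h =>
    ha ((QuotientAddGroup.norm_mk_eq_zero (S := p.toAddSubgroup) (hS := hp)).1 h)
  obtain ⟨g, -, hg⟩ := exists_dual_vector 𝕜 (p.mkQL a) hne
  refine ⟨g ∘L p.mkQL, fun x hx => ?_, ?_⟩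
  · have : p.mkQL x = 0 := (Submodule.Quotient.mk_eq_zero p).2 hx
    simp only [ContinuousLinearMap.comp_apply, this, map_zero]
  · rw [ContinuousLinearMap.comp_apply, hg]
    exact_mod_cast hne

theorem tendsto_toWeakSpace_iff {α : Type*} {l : Filter α} {u : α → E} {a : E} :
    Tendsto (fun n => toWeakSpace 𝕜 E (u n)) l (𝓝 (toWeakSpace 𝕜 E a)) ↔
      ∀ f : StrongDual 𝕜 E, Tendsto (fun n => f (u n)) l (𝓝 (f a)) := by
  refine WeakBilin.tendsto_iff_forall_eval_tendsto (topDualPairing 𝕜 E).flip fun x y hxy => ?_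
  exact (NormedSpace.inclusionInDoubleDualLi (E := E) 𝕜).injective
    (ContinuousLinearMap.ext fun f => LinearMap.congr_fun hxy f)

/-- A closed subspace is closed under weak cluster points of sequences. -/
theorem mem_of_forall_mapClusterPt {p : Submodule 𝕜 E} (hp : IsClosed (p : Set E)) {z : ℕ → E}
    (hz : ∀ n, z n ∈ p) {a : E}
    (ha : ∀ f : StrongDual 𝕜 E, MapClusterPt (f a) atTop fun n => f (z n)) : a ∈ p := by
  by_contra hap
  obtain ⟨f, hf, hfa⟩ := exists_dual_eq_zero_of_notMem hp hap
  have h := ha f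
  simp only [hf _ (hz _)] at h
  exact hfa (eq_of_mapClusterPt_of_tendsto h tendsto_const_nhds)

/-- A countable set of functionals separates the points of a separable subspace. -/
theorem exists_countable_separating {p : Submodule 𝕜 E}
    (hp : TopologicalSpace.IsSeparable (p : Set E)) :
    ∃ c : Set (StrongDual 𝕜 E), c.Countable ∧ ∀ x ∈ p, (∀ f ∈ c, f x = 0) → x = 0 := by
  obtain ⟨d, hd, hpd⟩ := hp
  choose g hg hgx using fun x : E => exists_dual_vector'' 𝕜 x
  refine ⟨g '' d, hd.image g, fun x hx hfx => ?_⟩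
  by_contra hne
  -- The norming functional of a nearby `y` vanishes at `x`, so `‖y‖ ≤ ‖x - y‖ < ‖x‖ / 2`, which is
  -- too small.
  obtain ⟨y, hyd, hxy⟩ := Metric.mem_closure_iff.1 (hpd hx) (‖x‖ / 2) (by positivity)
  rw [dist_eq_norm] at hxy
  have h1 : ‖y‖ ≤ ‖x - y‖ := by
    have h2 : g y (y - x) = ‖y‖ := by
      rw [map_sub, hgx, hfx _ ⟨y, hyd, rfl⟩, sub_zero]
    calc ‖y‖ = ‖g y (y - x)‖ := by rw [h2]; simp
      _ ≤ ‖y - x‖ := by simpa using (g y).le_of_opNorm_le (hg y) (y - x)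
      _ = ‖x - y‖ := norm_sub_rev _ _
  have h3 : ‖x‖ ≤ ‖x - y‖ + ‖y‖ := by simpa using norm_add_le (x - y) y
  linarith

/-- The Eberlein–Šmulian selection: a bounded sequence whose weak* cluster points in the second
dual all lie in the space has a weakly convergent subsequence. -/
theorem exists_subseq_weakly_tendsto {z : ℕ → E} (hb : Bornology.IsBounded (Set.range z))
    (hz : ∀ w : Bidual 𝕜 E,
      (∀ f : StrongDual 𝕜 E, MapClusterPt (w f) atTop fun n => f (z n)) → w ∈ canonicalCopy 𝕜 E) :
    ∃ (φ : ℕ → ℕ) (a : E), StrictMono φ ∧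
      ∀ f : StrongDual 𝕜 E, Tendsto (fun n => f (z (φ n))) atTop (𝓝 (f a)) := by
  obtain ⟨C, hC⟩ := hb.exists_norm_le
  replace hC : ∀ n, ‖z n‖ ≤ C := fun n => hC _ ⟨n, rfl⟩
  set L := (Submodule.span 𝕜 (Set.range z)).topologicalClosure with hL
  have hLc : IsClosed (L : Set E) := Submodule.isClosed_topologicalClosure _
  have hzL : ∀ n, z n ∈ L := fun n =>
    Submodule.le_topologicalClosure _ (Submodule.subset_span ⟨n, rfl⟩)
  have hLs : TopologicalSpace.IsSeparable (L : Set E) := by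
    rw [hL, Submodule.topologicalClosure_coe]
    exact ((Set.countable_range z).isSeparable.span (R := 𝕜)).closure
  obtain ⟨c, hc, hcL⟩ := exists_countable_separating hLs
  have := hc.to_subtype
  -- Diagonal extraction, as sequential compactness of a countable product of discs.
  obtain ⟨g, -, φ, hφ, hg⟩ := (isCompact_univ_pi fun f : c =>
      isCompact_closedBall (0 : 𝕜) (‖(f : StrongDual 𝕜 E)‖ * C)).tendsto_subseq
    (x := fun n (f : c) => (f : StrongDual 𝕜 E) (z n)) (fun n f _ => by
      rw [mem_closedBall_zero_iff]
      exact (f : StrongDual 𝕜 E).le_opNorm_of_le (hC n))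
  rw [tendsto_pi_nhds] at hg
  set u : ℕ → WeakDual 𝕜 (StrongDual 𝕜 E) := fun n =>
    StrongDual.toWeakDual (NormedSpace.inclusionInDoubleDual 𝕜 E (z (φ n))) with hu
  have hK := WeakDual.isCompact_closedBall (𝕜 := 𝕜) (0 : Bidual 𝕜 E) C
  have huK : ∀ n, u n ∈ WeakDual.toStrongDual ⁻¹' Metric.closedBall (0 : Bidual 𝕜 E) C := by
    intro n
    rw [Set.mem_preimage, mem_closedBall_zero_iff]
    exact (NormedSpace.double_dual_bound 𝕜 E _).trans (hC _)
  have eval : ∀ w : WeakDual 𝕜 (StrongDual 𝕜 E), MapClusterPt w atTop u →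
      ∀ f : StrongDual 𝕜 E, MapClusterPt (w f) atTop fun n => f (z (φ n)) := fun w hw f =>
    hw.continuousAt_comp (WeakDual.eval_continuous f).continuousAt
  have point : ∀ w : WeakDual 𝕜 (StrongDual 𝕜 E), MapClusterPt w atTop u →
      ∃ a ∈ L, ∀ f : StrongDual 𝕜 E, w f = f a := by
    intro w hw
    obtain ⟨a, ha⟩ := hz (WeakDual.toStrongDual w) fun f =>
      MapClusterPt.of_comp hφ.tendsto_atTop (eval w hw f)
    have ha' : ∀ f : StrongDual 𝕜 E, w f = f a := fun f => (DFunLike.congr_fun ha f).symm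
    refine ⟨a, mem_of_forall_mapClusterPt hLc (fun n => hzL (φ n)) fun f => ?_, ha'⟩
    rw [← ha']
    exact eval w hw f
  obtain ⟨w, -, hw⟩ := hK.exists_mapClusterPt (f := atTop) (u := u)
    (tendsto_principal.2 (Eventually.of_forall huK))
  obtain ⟨a, haL, ha⟩ := point w hw
  -- Every weak* cluster point comes from `L`, and its values on `c` are prescribed by `g`. It is
  -- therefore unique, and compactness gives convergence.
  have hlim : Tendsto u atTop (𝓝 w) := by
    refine hK.tendsto_nhds_of_unique_mapClusterPt (Eventually.of_forall huK) fun v _ hv => ?_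
    obtain ⟨b, hbL, hb⟩ := point v hv
    have hab : b - a = 0 := hcL _ (L.sub_mem hbL haL) fun f hf => by
      rw [map_sub, ← ha, ← hb, eq_of_mapClusterPt_of_tendsto (eval w hw f) (hg ⟨f, hf⟩),
        eq_of_mapClusterPt_of_tendsto (eval v hv f) (hg ⟨f, hf⟩), sub_self]
    refine DFunLike.ext _ _ fun f => ?_
    rw [ha, hb, sub_eq_zero.1 hab]
  refine ⟨φ, a, hφ, fun f => ?_⟩
  rw [← ha]
  exact ((WeakDual.eval_continuous f).tendsto w).comp hlim

/-- A finite-dimensional space of functionals is normed, up to a factor `2`, by finitely many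
vectors of the unit ball. -/
theorem exists_finset_norming {D : Type*} [NormedAddCommGroup D] [NormedSpace 𝕜 D]
    (V : Submodule 𝕜 (StrongDual 𝕜 D)) [FiniteDimensional 𝕜 V] :
    ∃ t : Finset D, (∀ f ∈ t, ‖f‖ ≤ 1) ∧ ∀ v ∈ V, v ≠ 0 → ∃ f ∈ t, ‖v‖ ≤ 2 * ‖v f‖ := by
  classical
  have : ProperSpace V := FiniteDimensional.proper 𝕜 V
  obtain ⟨t, ht⟩ := (isCompact_sphere (0 : V) 1).elim_finite_subcover
    (fun f : Metric.closedBall (0 : D) 1 => {v : V | 1 / 2 < ‖(v : StrongDual 𝕜 D) f‖})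
    (fun f => isOpen_lt continuous_const (by fun_prop)) (by
      intro v hv
      by_contra hcon
      simp only [Set.mem_iUnion, Set.mem_ofPred_eq, not_exists, not_lt] at hcon
      have h1 : ‖(v : StrongDual 𝕜 D)‖ ≤ 1 / 2 :=
        ContinuousLinearMap.opNorm_le_of_unit_norm (by norm_num) fun x hx =>
          hcon ⟨x, by simp [hx]⟩
      have h2 : ‖(v : StrongDual 𝕜 D)‖ = 1 := mem_sphere_zero_iff_norm.1 hv
      norm_num [h2] at h1)
  refine ⟨t.image Subtype.val, fun f hf => ?_, fun v hv hv0 => ?_⟩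
  · obtain ⟨g, -, rfl⟩ := Finset.mem_image.1 hf
    exact mem_closedBall_zero_iff.1 g.2
  · have hn : ‖v‖ ≠ 0 := norm_ne_zero_iff.2 hv0
    have hmem : ((‖v‖ : 𝕜)⁻¹ • (⟨v, hv⟩ : V)) ∈ Metric.sphere (0 : V) 1 := by
      rw [mem_sphere_zero_iff_norm, norm_smul, norm_inv, RCLike.norm_ofReal, abs_norm]
      exact inv_mul_cancel₀ hn
    obtain ⟨f, hft, hf⟩ := Set.mem_iUnion₂.1 (ht hmem)
    refine ⟨f, Finset.mem_image_of_mem _ hft, ?_⟩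
    have hf' : 1 / 2 < ‖v‖⁻¹ * ‖v (f : D)‖ := by simpa [norm_smul] using hf
    rw [inv_mul_eq_div, lt_div_iff₀ (by positivity)] at hf'
    linarith

/-- A set that norms a subspace of a dual space, up to a factor `2`, separates the points of its
closure. -/
theorem eq_zero_of_mem_closure_of_norming {D : Type*} [NormedAddCommGroup D] [NormedSpace 𝕜 D]
    {V : Set (StrongDual 𝕜 D)} {t : Set D} (ht : ∀ f ∈ t, ‖f‖ ≤ 1)
    (hV : ∀ v ∈ V, v ≠ 0 → ∃ f ∈ t, ‖v‖ ≤ 2 * ‖v f‖) {u : StrongDual 𝕜 D} (hu : u ∈ closure V)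
    (hut : ∀ f ∈ t, u f = 0) : u = 0 := by
  by_contra hne
  have hpos : 0 < ‖u‖ := norm_pos_iff.2 hne
  obtain ⟨v, hv, huv⟩ := Metric.mem_closure_iff.1 hu (‖u‖ / 3) (by positivity)
  rw [dist_eq_norm] at huv
  have h3 : ‖u‖ ≤ ‖u - v‖ + ‖v‖ := by simpa using norm_add_le (u - v) v
  have hv0 : v ≠ 0 := by
    rintro rfl
    rw [norm_zero] at h3
    linarith
  obtain ⟨f, hf, hvf⟩ := hV v hv hv0
  have h4 : ‖v f‖ ≤ ‖u - v‖ := by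
    have := (u - v).le_opNorm_of_le (ht f hf)
    simpa [hut f hf] using this
  linarith

/-- Whitley's construction: if a point `w` of the second dual is a weak* limit point of each of the
sets `C n`, there is a sequence `z n ∈ C n` such that `w` is the only possible weak limit of its
subsequences. -/
theorem exists_seq_forall_weak_limit_eq (w : Bidual 𝕜 E) (C : ℕ → Set E)
    (hC : ∀ (n : ℕ) (t : Finset (StrongDual 𝕜 E)) (ε : ℝ), 0 < ε →
      ∃ z ∈ C n, ∀ f ∈ t, ‖w f - f z‖ < ε) :
    ∃ z : ℕ → E, (∀ n, z n ∈ C n) ∧ ∀ (φ : ℕ → ℕ) (a : E), StrictMono φ →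
      (∀ f : StrongDual 𝕜 E, Tendsto (fun n => f (z (φ n))) atTop (𝓝 (f a))) →
      NormedSpace.inclusionInDoubleDual 𝕜 E a = w := by
  classical
  set J := NormedSpace.inclusionInDoubleDual 𝕜 E with hJ
  let V : Finset E → Submodule 𝕜 (Bidual 𝕜 E) := fun s =>
    Submodule.span 𝕜 ((insert w (s.image J) : Finset (Bidual 𝕜 E)) : Set (Bidual 𝕜 E))
  have hVmono : ∀ s s', s ⊆ s' → V s ≤ V s' := fun s s' h =>
    Submodule.span_mono (by
      exact_mod_cast Finset.insert_subset_insert w (Finset.image_subset_image h))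
  have hfin : ∀ s, FiniteDimensional 𝕜 (V s) := fun s => FiniteDimensional.span_finset 𝕜 _
  choose t ht1 ht using fun s => exists_finset_norming (V s)
  -- Using all subsets of `s` keeps later choices accurate on the norming sets of all earlier
  -- stages.
  choose g hgC hg using fun (n : ℕ) (s : Finset E) =>
    hC n (s.powerset.biUnion t) (1 / ((n : ℝ) + 1)) Nat.one_div_pos_of_nat
  let S : ℕ → Finset E := fun n => Nat.rec ∅ (fun k s => insert (g k s) s) n
  have hS : ∀ n, S (n + 1) = insert (g n (S n)) (S n) := fun n => rfl
  have hSmono : Monotone S := monotone_nat_of_le_succ fun n => by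
    rw [hS]; exact Finset.subset_insert _ _
  refine ⟨fun n => g n (S n), fun n => hgC _ _, fun φ a hφ ha => ?_⟩
  have hzero : ∀ f ∈ ⋃ n, (t (S n) : Set (StrongDual 𝕜 E)), (J a - w) f = 0 := by
    intro f hf
    obtain ⟨k, hk⟩ := Set.mem_iUnion.1 hf
    have h1 : Tendsto (fun n => f (g n (S n))) atTop (𝓝 (w f)) := by
      rw [tendsto_iff_norm_sub_tendsto_zero]
      refine squeeze_zero' (Eventually.of_forall fun n => norm_nonneg _) ?_
        (tendsto_one_div_add_atTop_nhds_zero_nat (𝕜 := ℝ))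
      filter_upwards [eventually_ge_atTop k] with n hn
      rw [norm_sub_rev]
      exact (hg n (S n) f (Finset.mem_biUnion.2
        ⟨S k, Finset.mem_powerset.2 (hSmono hn), hk⟩)).le
    have h2 := tendsto_nhds_unique (ha f) (h1.comp hφ.tendsto_atTop)
    simp [hJ, h2]
  have haL : a ∈ (Submodule.span 𝕜 (Set.range fun n => g n (S n))).topologicalClosure :=
    mem_of_forall_mapClusterPt (Submodule.isClosed_topologicalClosure _)
      (fun n => Submodule.le_topologicalClosure _ (Submodule.subset_span (Set.mem_range_self (φ n))))
      fun f => (ha f).mapClusterPt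
  have hdir : Directed (· ≤ ·) fun n => V (S n) :=
    (show Monotone fun n => V (S n) from fun m n h => hVmono _ _ (hSmono h)).directed_le
  have hU : ((⨆ n, V (S n) : Submodule 𝕜 (Bidual 𝕜 E)) : Set (Bidual 𝕜 E)) =
      ⋃ n, (V (S n) : Set (Bidual 𝕜 E)) := Submodule.coe_iSup_of_directed _ hdir
  -- The weak limit `a` lies in the norm-closed span of the chosen points, so `J a - w` is in the
  -- closure of a union of subspaces on which the chosen functionals are norming.
  have hmem : J a - w ∈ (⨆ n, V (S n)).topologicalClosure := by
    refine Submodule.sub_mem _ ?_ (Submodule.le_topologicalClosure _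
      (Submodule.mem_iSup_of_mem 0 (Submodule.subset_span (by simp))))
    have hle : Submodule.span 𝕜 (Set.range fun n => g n (S n)) ≤
        (⨆ n, V (S n)).comap J.toLinearMap := by
      rw [Submodule.span_le]
      rintro _ ⟨n, rfl⟩
      refine Submodule.mem_iSup_of_mem (n + 1) (Submodule.subset_span ?_)
      rw [hS]
      simp
    exact map_mem_closure J.continuous haL fun x hx => hle hx
  refine sub_eq_zero.1 (eq_zero_of_mem_closure_of_norming
    (V := ⋃ n, (V (S n) : Set (Bidual 𝕜 E))) (t := ⋃ n, (t (S n) : Set (StrongDual 𝕜 E)))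
    ?_ ?_ ?_ hzero)
  · intro f hf
    obtain ⟨k, hk⟩ := Set.mem_iUnion.1 hf
    exact ht1 _ _ hk
  · intro v hv hv0
    obtain ⟨k, hk⟩ := Set.mem_iUnion.1 hv
    obtain ⟨f, hf, hvf⟩ := ht _ v hk hv0
    exact ⟨f, Set.mem_iUnion.2 ⟨k, hf⟩, hvf⟩
  · rw [← hU]
    exact hmem

end WeakSequences

/-! ### Helly approximation and sequences for tauberian operators -/

section Approximation

variable {𝕜 : Type*} [RCLike 𝕜]

/-- Helly's condition: a point `h` that represents the image of `w ∈ E**` under the second conjugate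
of `B` is a limit of images of vectors of norm at most `‖w‖`. -/
theorem mem_closure_image_closedBall {E H : Type*} [SeminormedAddCommGroup E] [NormedSpace 𝕜 E]
    [SeminormedAddCommGroup H] [NormedSpace 𝕜 H] (B : E →L[𝕜] H) (w : Bidual 𝕜 E) (h : H)
    (hw : ∀ ψ : StrongDual 𝕜 H, w (ψ ∘L B) = ψ h) :
    h ∈ closure (B '' Metric.closedBall 0 ‖w‖) := by
  let := NormedSpace.restrictScalars ℝ 𝕜 H
  let := NormedSpace.restrictScalars ℝ 𝕜 E
  have : IsScalarTower ℝ 𝕜 H := RestrictScalars.isScalarTower ℝ 𝕜 H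
  have : IsScalarTower ℝ 𝕜 E := RestrictScalars.isScalarTower ℝ 𝕜 E
  by_contra hh
  have hconv : Convex ℝ (closure (B '' Metric.closedBall 0 ‖w‖)) :=
    ((convex_closedBall (0 : E) ‖w‖).linear_image (B.toLinearMap.restrictScalars ℝ)).closure
  obtain ⟨ψ, r, hψ, hr⟩ :=
    RCLike.geometric_hahn_banach_closed_point (𝕜 := 𝕜) hconv isClosed_closure hh
  have hball : ∀ x : E, ‖x‖ ≤ ‖w‖ → RCLike.re (ψ (B x)) < r := fun x hx =>
    hψ _ (subset_closure ⟨x, mem_closedBall_zero_iff.2 hx, rfl⟩)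
  have hr0 : 0 < r := by simpa using hball 0 (by simp)
  -- Rotating by a unit scalar turns the bound on real parts into a norm bound, which contradicts `r
  -- < re (ψ h)`, as `ψ h = w (ψ ∘L B)`.
  have hle : ‖(‖w‖ : 𝕜) • (ψ ∘L B)‖ ≤ r := by
    refine ContinuousLinearMap.opNorm_le_of_unit_norm hr0.le fun x hx => ?_
    obtain ⟨c, hc, hcx⟩ := RCLike.exists_norm_eq_mul_self (ψ (B x))
    have h1 := hball (((‖w‖ : 𝕜) * c) • x) (by simp [norm_smul, hc, hx])
    have h2 : ψ (B (((‖w‖ : 𝕜) * c) • x)) = ((‖w‖ * ‖ψ (B x)‖ : ℝ) : 𝕜) := by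
      rw [map_smul, map_smul, smul_eq_mul, mul_assoc, ← hcx, RCLike.ofReal_mul]
    rw [h2, RCLike.ofReal_re] at h1
    simpa [norm_smul] using h1.le
  rw [norm_smul, RCLike.norm_ofReal, abs_norm] at hle
  have h3 : RCLike.re (ψ h) ≤ ‖w‖ * ‖ψ ∘L B‖ := by
    rw [← hw]
    exact (RCLike.re_le_norm _).trans (w.le_opNorm _)
  linarith

variable {E F : Type*} [NormedAddCommGroup E] [NormedSpace 𝕜 E]
  [SeminormedAddCommGroup F] [NormedSpace 𝕜 F]

/-- Helly's condition for `z ↦ (S z, (f z)_{f ∈ t})` controls the norm, the image and finitely many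
functionals at once. -/
theorem exists_norm_le_approx (S : E →L[𝕜] F) {w : Bidual 𝕜 E} {q : F}
    (hw : secondConjugate S w = NormedSpace.inclusionInDoubleDual 𝕜 F q)
    (t : Finset (StrongDual 𝕜 E)) {ε : ℝ} (hε : 0 < ε) :
    ∃ z : E, ‖z‖ ≤ ‖w‖ ∧ ‖q - S z‖ < ε ∧ ∀ f ∈ t, ‖w f - f z‖ < ε := by
  classical
  have hmem := mem_closure_image_closedBall
    (S.prod (ContinuousLinearMap.pi fun f : t => (f : StrongDual 𝕜 E))) w
    (q, fun f : t => w f) fun ψ => by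
      set ρ : StrongDual 𝕜 (t → 𝕜) := ψ ∘L ContinuousLinearMap.inr 𝕜 F (t → 𝕜) with hρ
      have hsplit : ∀ a b, ψ (a, b) = (ψ ∘L ContinuousLinearMap.inl 𝕜 F (t → 𝕜)) a +
          ∑ i, b i * ρ (Pi.single i 1) := fun a b => by
        have h1 : ρ b = ∑ i, b i * ρ (Pi.single i 1) := by
          conv_lhs => rw [pi_eq_sum_univ' b]
          simp [map_sum]
        rw [← h1, hρ, ContinuousLinearMap.comp_apply, ContinuousLinearMap.comp_apply, ← map_add]
        simp
      have hcomp : ψ ∘L (S.prod (ContinuousLinearMap.pi fun f : t => (f : StrongDual 𝕜 E))) =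
          (ψ ∘L ContinuousLinearMap.inl 𝕜 F (t → 𝕜)) ∘L S +
            ∑ i : t, ρ (Pi.single i 1) • (i : StrongDual 𝕜 E) := by
        ext z
        rw [ContinuousLinearMap.comp_apply, ContinuousLinearMap.prod_apply, hsplit]
        simp [mul_comm]
      have hS := DFunLike.congr_fun hw (ψ ∘L ContinuousLinearMap.inl 𝕜 F (t → 𝕜))
      rw [hcomp, map_add, map_sum, hsplit]
      refine congrArg₂ (· + ·) hS (Finset.sum_congr rfl fun i _ => ?_)
      rw [map_smul, smul_eq_mul, mul_comm]
  obtain ⟨_, ⟨z, hz, rfl⟩, hd⟩ := Metric.mem_closure_iff.1 hmem ε hε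
  rw [Prod.dist_eq, max_lt_iff, dist_pi_lt_iff hε] at hd
  refine ⟨z, mem_closedBall_zero_iff.1 hz, ?_, fun f hf => ?_⟩
  · rw [← dist_eq_norm]
    exact hd.1
  · rw [← dist_eq_norm]
    exact hd.2 ⟨f, hf⟩

/-- If `S**` maps `w` into `F`, there is a bounded sequence whose images converge in norm and of
whose subsequences `w` is the only possible weak limit. -/
theorem exists_bounded_seq_of_secondConjugate_eq (S : E →L[𝕜] F) {w : Bidual 𝕜 E} {q : F}
    (hw : secondConjugate S w = NormedSpace.inclusionInDoubleDual 𝕜 F q) :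
    ∃ z : ℕ → E, (∀ n, ‖z n‖ ≤ ‖w‖) ∧ Tendsto (fun n => S (z n)) atTop (𝓝 q) ∧
      ∀ (φ : ℕ → ℕ) (a : E), StrictMono φ →
        (∀ f : StrongDual 𝕜 E, Tendsto (fun n => f (z (φ n))) atTop (𝓝 (f a))) →
        NormedSpace.inclusionInDoubleDual 𝕜 E a = w := by
  obtain ⟨z, hz, hlim⟩ := exists_seq_forall_weak_limit_eq w
    (fun n => {z : E | ‖z‖ ≤ ‖w‖ ∧ ‖q - S z‖ < 1 / ((n : ℝ) + 1)}) fun n t ε hε => by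
      obtain ⟨z, h1, h2, h3⟩ := exists_norm_le_approx S hw t
        (lt_min hε (Nat.one_div_pos_of_nat (α := ℝ) (n := n)))
      exact ⟨z, ⟨h1, h2.trans_le (min_le_right _ _)⟩,
        fun f hf => (h3 f hf).trans_le (min_le_left _ _)⟩
  refine ⟨z, fun n => (hz n).1, ?_, hlim⟩
  rw [tendsto_iff_norm_sub_tendsto_zero]
  refine squeeze_zero (fun n => norm_nonneg _) (fun n => ?_)
    (tendsto_one_div_add_atTop_nhds_zero_nat (𝕜 := ℝ))
  rw [norm_sub_rev]
  exact (hz n).2.le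

/-- Under a tauberian operator, a bounded sequence with weakly convergent images has a weakly
convergent subsequence. -/
theorem IsTauberian.exists_subseq_weakly_tendsto {S : E →L[𝕜] F} (hS : IsTauberian S) {z : ℕ → E}
    (hb : Bornology.IsBounded (Set.range z)) {q : F}
    (hq : ∀ h : StrongDual 𝕜 F, Tendsto (fun n => h (S (z n))) atTop (𝓝 (h q))) :
    ∃ (φ : ℕ → ℕ) (a : E), StrictMono φ ∧
      ∀ f : StrongDual 𝕜 E, Tendsto (fun n => f (z (φ n))) atTop (𝓝 (f a)) := by
  refine TauberianPair.exists_subseq_weakly_tendsto hb fun w hw => ?_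
  by_contra hcon
  exact hS hcon ⟨q, ContinuousLinearMap.ext fun h =>
    (eq_of_mapClusterPt_of_tendsto (hw (h ∘L S)) (hq h)).symm⟩

end Approximation

/-! ### Pairs of closed subspaces and residual spaces -/

section Pairs

variable {𝕜 : Type*} [RCLike 𝕜]
variable {Z : Type*} [NormedAddCommGroup Z] [NormedSpace 𝕜 Z]

/-- The inclusion of a closed subspace is tauberian. -/
theorem mem_canonicalCopy_of_subtypeL (M : ClosedSubmodule 𝕜 Z) {w : Bidual 𝕜 M.toSubmodule}
    (hw : secondConjugate M.toSubmodule.subtypeL w ∈ canonicalCopy 𝕜 Z) :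
    w ∈ canonicalCopy 𝕜 M.toSubmodule := by
  obtain ⟨z, hz⟩ := hw
  have hz' : ∀ f : StrongDual 𝕜 Z, w (f ∘L M.toSubmodule.subtypeL) = f z := fun f =>
    (DFunLike.congr_fun hz f).symm
  have hzM : z ∈ M.toSubmodule := by
    by_contra hcon
    obtain ⟨f, hf, hfz⟩ := exists_dual_eq_zero_of_notMem M.isClosed hcon
    have h0 : f ∘L M.toSubmodule.subtypeL = 0 := ContinuousLinearMap.ext fun m => hf m m.2
    have h1 := hz' f
    rw [h0, map_zero] at h1
    exact hfz h1.symm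
  refine ⟨⟨z, hzM⟩, ContinuousLinearMap.ext fun g => ?_⟩
  obtain ⟨f, hf, -⟩ := exists_extension_norm_eq M.toSubmodule g
  have hfg : f ∘L M.toSubmodule.subtypeL = g := ContinuousLinearMap.ext hf
  have h1 := hz' f
  rw [hfg] at h1
  exact ((hf ⟨z, hzM⟩).symm.trans h1.symm)

/-- The kernel of `(Q_N)**` is contained in the range of `(J_N)**`. -/
theorem exists_secondConjugate_subtypeL_eq (N : Submodule 𝕜 Z) {u : Bidual 𝕜 Z}
    (hu : secondConjugate N.mkQL u = 0) :
    ∃ v : Bidual 𝕜 N, secondConjugate N.subtypeL v = u := by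
  choose e he hnorm using fun g : StrongDual 𝕜 N => exists_extension_norm_eq N g
  -- `u` vanishes on functionals that factor through `Z/N`, so its value does not depend on the
  -- extension chosen.
  have key : ∀ f f' : StrongDual 𝕜 Z, (∀ x : N, f x = f' x) → u f = u f' := by
    intro f f' hff
    have hker : N ≤ ((f - f' : StrongDual 𝕜 Z) : Z →ₗ[𝕜] 𝕜).ker := fun x hx => by
      simpa using sub_eq_zero.2 (hff ⟨x, hx⟩)
    have h1 : N.liftQL (f - f') hker ∘L N.mkQL = f - f' := ContinuousLinearMap.ext fun x => rfl
    have h2 : u (N.liftQL (f - f') hker ∘L N.mkQL) = 0 := DFunLike.congr_fun hu _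
    rw [h1, map_sub] at h2
    exact sub_eq_zero.1 h2
  let v : StrongDual 𝕜 N →ₗ[𝕜] 𝕜 :=
    { toFun := fun g => u (e g)
      map_add' := fun g g' => by
        rw [← map_add]
        exact key _ _ fun x => by simp [he]
      map_smul' := fun c g => by
        rw [← map_smul]
        exact key _ _ fun x => by simp [he] }
  refine ⟨v.mkContinuous ‖u‖ fun g => ?_, ContinuousLinearMap.ext fun f => ?_⟩
  · rw [← hnorm]
    exact u.le_opNorm _
  · exact key _ _ fun x => he (f ∘L N.subtypeL) x

/-- A pair of closed subspaces is tauberian if and only if the associated subspaces of the residual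
space intersect trivially. -/
theorem isTauberianPair_iff_co_inf_co_eq_bot (M N : ClosedSubmodule 𝕜 Z) :
    IsTauberianPair M N ↔ co M ⊓ co N = ⊥ := by
  constructor
  · intro h
    refine (Submodule.eq_bot_iff _).2 fun ξ hξ => ?_
    obtain ⟨⟨μ, rfl⟩, ⟨ν, hν⟩⟩ := hξ
    obtain ⟨m, rfl⟩ := Submodule.Quotient.mk_surjective _ μ
    obtain ⟨n, rfl⟩ := Submodule.Quotient.mk_surjective _ ν
    obtain ⟨z, hz⟩ : secondConjugate N.toSubmodule.subtypeL n -
        secondConjugate M.toSubmodule.subtypeL m ∈ canonicalCopy 𝕜 Z :=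
      (Submodule.Quotient.eq _).1 hν
    have hQN : secondConjugate N.toSubmodule.mkQL
        (secondConjugate N.toSubmodule.subtypeL n) = 0 := by
      refine ContinuousLinearMap.ext fun f => ?_
      have h0 : (f ∘L N.toSubmodule.mkQL) ∘L N.toSubmodule.subtypeL = 0 :=
        ContinuousLinearMap.ext fun x => by
          have : N.toSubmodule.mkQL (x : Z) = 0 := (Submodule.Quotient.mk_eq_zero _).2 x.2
          simp only [ContinuousLinearMap.comp_apply, Submodule.subtypeL_apply, this, map_zero,
            zero_apply]
      exact (congrArg n h0).trans (map_zero n)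
    have hm : m ∈ canonicalCopy 𝕜 M.toSubmodule := by
      by_contra hcon
      refine h hcon ⟨N.toSubmodule.mkQL (-z), ?_⟩
      have h1 : secondConjugate M.toSubmodule.subtypeL m =
          secondConjugate N.toSubmodule.subtypeL n - NormedSpace.inclusionInDoubleDual 𝕜 Z z := by
        rw [show NormedSpace.inclusionInDoubleDual 𝕜 Z z = _ from hz]
        abel
      have h2 : secondConjugate (pairOperator M N) m =
          secondConjugate N.toSubmodule.mkQL (secondConjugate M.toSubmodule.subtypeL m) := rfl
      rw [h2, h1, map_sub, hQN, zero_sub, map_neg, map_neg]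
      rfl
    rw [(Submodule.Quotient.mk_eq_zero _).2 hm, map_zero]
  · intro h m hm hcon
    obtain ⟨q, hq⟩ := hcon
    obtain ⟨z, rfl⟩ := Submodule.Quotient.mk_surjective _ q
    obtain ⟨n, hn⟩ := exists_secondConjugate_subtypeL_eq N.toSubmodule
      (u := secondConjugate M.toSubmodule.subtypeL m - NormedSpace.inclusionInDoubleDual 𝕜 Z z) (by
        rw [map_sub, sub_eq_zero]
        exact hq.symm)
    have hmem : residuum M.toSubmodule.subtypeL (Submodule.Quotient.mk m) ∈ co M ⊓ co N := by
      refine ⟨⟨_, rfl⟩, Submodule.Quotient.mk n, (Submodule.Quotient.eq _).2 ?_⟩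
      refine ⟨-z, ?_⟩
      change _ = secondConjugate N.toSubmodule.subtypeL n -
        secondConjugate M.toSubmodule.subtypeL m
      rw [hn, map_neg]
      change -NormedSpace.inclusionInDoubleDual 𝕜 Z z = _
      abel
    rw [h] at hmem
    exact hm (mem_canonicalCopy_of_subtypeL M
      ((Submodule.Quotient.mk_eq_zero _).1 ((Submodule.mem_bot 𝕜).1 hmem)))

end Pairs

/-! ### Graphs of closed operators -/

section ClosedOperators

variable {𝕜 : Type*} [RCLike 𝕜]
variable {X Y : Type*} [NormedAddCommGroup X] [NormedSpace 𝕜 X]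
  [NormedAddCommGroup Y] [NormedSpace 𝕜 Y]

/-- Uniform boundedness on the dual of `Y`. Boundedness of the `x n` alone would not bound the graph
points. -/
theorem exists_norm_le_of_forall_tendsto {v : ℕ → Y} {y : Y}
    (hv : ∀ f : StrongDual 𝕜 Y, Tendsto (fun n => f (v n)) atTop (𝓝 (f y))) :
    ∃ C, ∀ n, ‖v n‖ ≤ C := by
  obtain ⟨C, hC⟩ := banach_steinhaus
    (g := fun n => NormedSpace.inclusionInDoubleDual 𝕜 Y (v n)) fun f => by
      obtain ⟨c, hc⟩ := (Metric.isBounded_range_of_tendsto _ (hv f)).exists_norm_le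
      exact ⟨c, fun n => hc _ ⟨n, rfl⟩⟩
  exact ⟨C, fun n =>
    ((NormedSpace.inclusionInDoubleDualLi (E := Y) 𝕜).norm_map (v n)).symm.le.trans (hC n)⟩

/-- The graph point over an element of the domain. -/
def graphPoint (T : X →ₗ.[𝕜] Y) (hT : T.IsClosed) (x : T.domain) :
    (closedGraph T hT).toSubmodule :=
  ⟨(x, T x), T.mem_graph x⟩

theorem exists_graphPoint_eq (T : X →ₗ.[𝕜] Y) (hT : T.IsClosed)
    (p : (closedGraph T hT).toSubmodule) : ∃ x : T.domain, graphPoint T hT x = p := by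
  obtain ⟨⟨a, b⟩, hp⟩ := p
  obtain ⟨x, hx, hy⟩ := (LinearPMap.mem_graph_iff T).1 hp
  exact ⟨x, Subtype.ext (Prod.ext hx hy)⟩

theorem mkQL_firstFactor_eq (x : X) (y : Y) :
    (firstFactor 𝕜 X Y).toSubmodule.mkQL (x, y) = (firstFactor 𝕜 X Y).toSubmodule.mkQL (0, y) :=
  (Submodule.Quotient.eq _).2 ⟨trivial, by simp⟩

/-- The identification of `(X × Y) / X` with `Y`. -/
def quotientSnd : ((X × Y) ⧸ (firstFactor 𝕜 X Y).toSubmodule) →L[𝕜] Y :=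
  (firstFactor 𝕜 X Y).toSubmodule.liftQL (ContinuousLinearMap.snd 𝕜 X Y) fun _ hp => hp.2

/-- The weak limit is found inside `G(T)`, so it has the form `(a, T a)`; its second coordinate must
be `y`. -/
theorem exists_subseq_of_isTauberianPair (T : X →ₗ.[𝕜] Y) (hT : T.IsClosed)
    (h : IsTauberianPair (closedGraph T hT) (firstFactor 𝕜 X Y)) (x : ℕ → T.domain) (y : Y)
    (hx : Bornology.IsBounded (Set.range fun n => (x n : X)))
    (hy : ∀ f : StrongDual 𝕜 Y, Tendsto (fun n => f (T (x n))) atTop (𝓝 (f y))) :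
    ∃ (φ : ℕ → ℕ) (a : T.domain), StrictMono φ ∧
      (∀ f : StrongDual 𝕜 X, Tendsto (fun n => f (x (φ n))) atTop (𝓝 (f a))) ∧ T a = y := by
  obtain ⟨C, hC⟩ := hx.exists_norm_le
  obtain ⟨D, hD⟩ := exists_norm_le_of_forall_tendsto hy
  have hb : Bornology.IsBounded (Set.range fun n => graphPoint T hT (x n)) := by
    refine isBounded_iff_forall_norm_le.2 ⟨max C D, ?_⟩
    rintro _ ⟨n, rfl⟩
    exact max_le_max (hC _ ⟨n, rfl⟩) (hD n)
  obtain ⟨φ, p, hφ, hp⟩ := h.exists_subseq_weakly_tendsto hb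
    (q := (firstFactor 𝕜 X Y).toSubmodule.mkQL (0, y)) fun g => by
      refine (hy ((g ∘L (firstFactor 𝕜 X Y).toSubmodule.mkQL) ∘L
        ContinuousLinearMap.inr 𝕜 X Y)).congr fun n => ?_
      exact congrArg g (mkQL_firstFactor_eq (𝕜 := 𝕜) (x n : X) (T (x n))).symm
  obtain ⟨a, rfl⟩ := exists_graphPoint_eq T hT p
  refine ⟨φ, a, hφ, fun f => hp ((f ∘L ContinuousLinearMap.fst 𝕜 X Y) ∘L
    (closedGraph T hT).toSubmodule.subtypeL), ?_⟩
  refine (NormedSpace.inclusionInDoubleDualLi (E := Y) 𝕜).injective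
    (ContinuousLinearMap.ext fun f => ?_)
  exact tendsto_nhds_unique (hp ((f ∘L ContinuousLinearMap.snd 𝕜 X Y) ∘L
    (closedGraph T hT).toSubmodule.subtypeL)) ((hy f).comp hφ.tendsto_atTop)

theorem isTauberianPair_of_exists_subseq (T : X →ₗ.[𝕜] Y) (hT : T.IsClosed)
    (h : ∀ (x : ℕ → T.domain) (y : Y), Bornology.IsBounded (Set.range fun n => (x n : X)) →
      (∀ f : StrongDual 𝕜 Y, Tendsto (fun n => f (T (x n))) atTop (𝓝 (f y))) →
      ∃ (φ : ℕ → ℕ) (a : T.domain), StrictMono φ ∧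
        (∀ f : StrongDual 𝕜 X, Tendsto (fun n => f (x (φ n))) atTop (𝓝 (f a))) ∧ T a = y) :
    IsTauberianPair (closedGraph T hT) (firstFactor 𝕜 X Y) := by
  rintro w hw ⟨q, hq⟩
  obtain ⟨z, hz, hzq, hlim⟩ := exists_bounded_seq_of_secondConjugate_eq _ hq.symm
  choose x hx using fun n => exists_graphPoint_eq T hT (z n)
  obtain rfl : (fun n => graphPoint T hT (x n)) = z := funext hx
  have hT : Tendsto (fun n => T (x n)) atTop (𝓝 (quotientSnd q)) :=
    (quotientSnd.continuous.tendsto q).comp hzq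
  obtain ⟨φ, a, hφ, ha, hay⟩ := h x (quotientSnd q)
    (isBounded_iff_forall_norm_le.2 ⟨‖w‖, by
      rintro _ ⟨n, rfl⟩
      exact (le_max_left _ _).trans (hz n)⟩)
    fun f => (f.continuous.tendsto _).comp hT
  refine hw ⟨graphPoint T _ a, hlim φ _ hφ fun g => ?_⟩
  -- A functional on the graph extends to `X × Y` and splits there into one on `X` and one on `Y`.
  obtain ⟨G, hG, -⟩ := exists_extension_norm_eq _ g
  have hsplit : ∀ b : T.domain, g (graphPoint T _ b) =
      (G ∘L ContinuousLinearMap.inl 𝕜 X Y) b + (G ∘L ContinuousLinearMap.inr 𝕜 X Y) (T b) := by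
    intro b
    rw [← hG, ContinuousLinearMap.comp_apply, ContinuousLinearMap.comp_apply, ← map_add]
    simp [graphPoint]
  simp only [hsplit]
  refine (ha _).add ?_
  rw [hay]
  exact ((ContinuousLinearMap.continuous _).tendsto _).comp (hT.comp hφ.tendsto_atTop)

end ClosedOperators

end TauberianPair

end

theorem mainTheorem9 {𝕜 : Type*} [RCLike 𝕜]
    {X : Type*} [NormedAddCommGroup X] [NormedSpace 𝕜 X] [CompleteSpace X]
    {Y : Type*} [NormedAddCommGroup Y] [NormedSpace 𝕜 Y] [CompleteSpace Y]
    (T : X →ₗ.[𝕜] Y) (hT : T.IsClosed) :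
    List.TFAE [
      TauberianPair.IsTauberianPair (TauberianPair.closedGraph T hT)
        (TauberianPair.firstFactor 𝕜 X Y),
      TauberianPair.co (TauberianPair.closedGraph T hT) ⊓
        TauberianPair.co (TauberianPair.firstFactor 𝕜 X Y) = ⊥,
      ∀ (x : ℕ → T.domain) (y : Y),
        Bornology.IsBounded (Set.range fun n => (x n : X)) →
        Tendsto (fun n => toWeakSpace 𝕜 Y (T (x n))) atTop (𝓝 (toWeakSpace 𝕜 Y y)) →
        ∃ (φ : ℕ → ℕ) (a : T.domain), StrictMono φ ∧
          Tendsto (fun n => toWeakSpace 𝕜 X (x (φ n) : X)) atTop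
            (𝓝 (toWeakSpace 𝕜 X (a : X))) ∧
          T a = y] := by
  tfae_have 1 ↔ 2 := TauberianPair.isTauberianPair_iff_co_inf_co_eq_bot _ _
  tfae_have 1 → 3 := fun h x y hx hy => by
    simp only [TauberianPair.tendsto_toWeakSpace_iff] at hy ⊢
    exact TauberianPair.exists_subseq_of_isTauberianPair T hT h x y hx hy
  tfae_have 3 → 1 := fun h => by
    simp only [TauberianPair.tendsto_toWeakSpace_iff] at h
    exact TauberianPair.isTauberianPair_of_exists_subseq T hT h
  tfae_finish
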